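/- **Theorem 1.4.** For $n=0,1,2,\ldots$ put $$S_n=\sum_{k=0}^n\binom nk^2\binom{2k}k(2k+1),\qquad S_n(x)=\sum_{k=0}^n\binom nk^2\binom{2k}k(2k+1)x^k,$$ and let $C_k=\frac1{k+1}\binom{2k}k$ denote the $k$-th Catalan number. (i) For every positive integer $n$, $$\frac1{n^2}\sum_{k=0}^{n-1}S_k=\sum_{k=0}^{n-1}\binom{n-1}k^2C_k\in\mathbb Z \qquad\text{and}\qquad \frac1n\sum_{k=0}^{n-1}S_k(x)\in\mathbb Z[x].$$ (ii) For every prime $p>3$, $$\sum_{k=1}^{p-1}\frac{S_k}k\equiv p\sum_{k=1}^{p-1}\frac{S_k}{k^2}\equiv-\frac p2\left(\frac p3\right)B_{p-2}\left(\frac13\right)\pmod{p^2},$$ where $\left(\frac{\cdot}{3}\right)$ is the Legendre symbol modulo $3$, $B_n(x)$ is the $n$-th Bernoulli polynomial, and for rational numbers $a,b$ the congruence $a\equiv b\pmod{p^2}$ means that $a-b=p^2c$ for some rational number $c$ whose denominator in lowest terms is not divisible by $p$. -/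

import Mathlib

/-- The numbers `S n = ∑_{k=0}^n (n choose k)^2 (2k choose k) (2k+1)`. -/
def sunS (n : ℕ) : ℤ :=
  ∑ k ∈ Finset.range (n + 1), (n.choose k : ℤ) ^ 2 * ((2 * k).choose k : ℤ) * (2 * (k : ℤ) + 1)

/-- The associated polynomials `S n (x) = ∑_{k=0}^n (n choose k)^2 (2k choose k) (2k+1) x^k`. -/
noncomputable def sunSPoly (n : ℕ) : Polynomial ℤ :=
  ∑ k ∈ Finset.range (n + 1),
    Polynomial.C ((n.choose k : ℤ) ^ 2 * ((2 * k).choose k : ℤ) * (2 * (k : ℤ) + 1)) *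
      Polynomial.X ^ k

/-- Congruence of rational numbers modulo a positive integer `m`: the difference is `m` times a
rational number whose (reduced) denominator is coprime to `m`. -/
def RatModEq (m : ℕ) (a b : ℚ) : Prop :=
  ∃ c : ℚ, c.den.Coprime m ∧ a - b = (m : ℚ) * c

open Finset

/-! Part (i), numbers. Put `T n = ∑ C(n,k)^2 * catalan k`. Then `sunS (n+1) = (n+2)^2 * T (n+1) -
(n+1)^2 * T n`, so the partial sums telescope. The difference of the two sides is a multiple of the
first-moment identity in `three_mul_sum_mul_choose_sq`, which comes from the symmetry of squared
trinomial coefficients.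

Part (i), polynomials. The coefficient of `x^j` in the partial sum is `(2j+1) C(2j,j) ∑_{m<n}
C(m,j)^2`. Linearising the square and applying the hockey-stick identity exhibits the factor `n`
(`central_mul_sum_choose_sq`).

Part (ii). Both left-hand quantities have the form `p * a` with `a` a `p`-integral rational, so it
suffices to compute residues modulo `p`. Exchanging summations reduces them to inner sums over `k`
of `C(k,j)^2 / k` and `(C(k,j)/k)^2`. The first is evaluated modulo `p^2` by a recurrence in `j`,
the second modulo `p` by the divisibility from part (i). Both lead to minus `∑ (2j+1) C(2j,j) /
j^2`.

That sum is found with finite polylogarithms over `𝔽_p`: `∑ C(2k,k) (X(1-X))^k / k^s` is `2 £_1(X)`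
for `s = 1` and `2 (£_2(X) + £_2(1-X))` for `s = 2`, where `£_s = ∑ X^k / k^s`. At a root of `x(1-x)
= 1`, a primitive sixth root of unity, these become sums over classes modulo 3. The result is `∑_{m
≤ p/3} 1/m^2`, which Faulhaber's formula turns into `(p/3) B_{p-2}(1/3) / 2`. -/

/-! ### Part (i): the telescoping evaluation of the partial sums. -/

/-- Since `C(2k,k) = ∑ C(k,b)^2`, both sums run over squared trinomial coefficients `(n!/(a! b!
c!))^2` with `a + b + c = n` and `k = a + b`. By symmetry each of `a`, `b`, `c` has weighted mean
`n/3`, so `k` has mean `2n/3`. -/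
theorem three_mul_sum_mul_choose_sq (n : ℕ) :
    3 * ∑ k ∈ range (n + 1), (k : ℤ) * ((n.choose k : ℤ) ^ 2 * ((2 * k).choose k : ℤ)) =
      2 * n * ∑ k ∈ range (n + 1), (n.choose k : ℤ) ^ 2 * ((2 * k).choose k : ℤ) := by
  have central (k : ℕ) : ((2 * k).choose k : ℤ) = ∑ b ∈ range (k + 1), (k.choose b : ℤ) ^ 2 := by
    exact_mod_cast (Nat.sum_range_choose_sq k).symm
  have half (k : ℕ) : (k : ℤ) * ((2 * k).choose k : ℤ) =
      2 * ∑ b ∈ range (k + 1), (b : ℤ) * (k.choose b : ℤ) ^ 2 := by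
    have h := sum_range_reflect (fun b ↦ (b : ℤ) * (k.choose b : ℤ) ^ 2) (k + 1)
    suffices h' : (k : ℤ) * ((2 * k).choose k : ℤ) =
        ∑ b ∈ range (k + 1), (b : ℤ) * (k.choose b : ℤ) ^ 2 +
        ∑ b ∈ range (k + 1), (b : ℤ) * (k.choose b : ℤ) ^ 2 by rw [h', two_mul]
    -- Reflecting `b ↦ k - b` in only one of the two copies makes the weights add up to `k`.
    nth_rewrite 1 [← h]
    rw [central, mul_sum, ← sum_add_distrib]
    refine sum_congr rfl fun b hb ↦ ?_
    have hb : b ≤ k := by simpa [Nat.lt_succ_iff] using hb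
    simp only [Nat.add_sub_cancel, Nat.choose_symm hb, Nat.cast_sub hb]
    ring
  have swap : ∑ k ∈ range (n + 1), ∑ b ∈ range (k + 1),
        (b : ℤ) * ((n.choose k : ℤ) * (k.choose b : ℤ)) ^ 2 =
      ∑ b ∈ range (n + 1), (b : ℤ) * (n.choose b : ℤ) ^ 2 *
        ((2 * (n - b)).choose (n - b) : ℤ) := by
    simp_rw [central, mul_sum]
    rw [sum_sigma', sum_sigma']
    refine sum_bij' (fun x _ ↦ ⟨x.2, x.1 - x.2⟩) (fun x _ ↦ ⟨x.1 + x.2, x.1⟩) ?_ ?_ ?_ ?_ ?_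
    · rintro ⟨k, b⟩ h
      simp only [mem_sigma, mem_range] at h ⊢
      omega
    · rintro ⟨k, b⟩ h
      simp only [mem_sigma, mem_range] at h ⊢
      omega
    · rintro ⟨k, b⟩ h
      simp only [mem_sigma, mem_range] at h ⊢
      simp only [Sigma.mk.injEq, heq_eq_eq, and_true]
      omega
    · rintro ⟨k, b⟩ h
      simp only [mem_sigma, mem_range] at h ⊢
      simp
    · rintro ⟨k, b⟩ h
      simp only [mem_sigma, mem_range] at h ⊢
      have := Nat.choose_mul (n := n) (k := k) (s := b) (by omega)
      have this : (n.choose k : ℤ) * k.choose b = n.choose b * (n - b).choose (k - b) := by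
        exact_mod_cast this
      rw [this]
      ring
  have h1 : ∑ k ∈ range (n + 1), (k : ℤ) * ((n.choose k : ℤ) ^ 2 * ((2 * k).choose k : ℤ)) =
      2 * ∑ b ∈ range (n + 1), (b : ℤ) * (n.choose b : ℤ) ^ 2 *
        ((2 * (n - b)).choose (n - b) : ℤ) := by
    rw [← swap, mul_sum]
    refine sum_congr rfl fun k _ ↦ ?_
    rw [mul_left_comm, half, mul_left_comm, mul_sum]
    congr 1
    exact sum_congr rfl fun b _ ↦ by ring
  have h2 : ∑ b ∈ range (n + 1), (b : ℤ) * (n.choose b : ℤ) ^ 2 *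
        ((2 * (n - b)).choose (n - b) : ℤ) =
      ∑ k ∈ range (n + 1), ((n : ℤ) - k) * ((n.choose k : ℤ) ^ 2 * ((2 * k).choose k : ℤ)) := by
    rw [← sum_range_reflect]
    refine sum_congr rfl fun b hb ↦ ?_
    have hb : b ≤ n := by simpa [Nat.lt_succ_iff] using hb
    simp only [Nat.add_sub_cancel, Nat.choose_symm hb, Nat.cast_sub hb, Nat.sub_sub_self hb]
    ring
  have h3 : ∑ k ∈ range (n + 1), ((n : ℤ) - k) * ((n.choose k : ℤ) ^ 2 * ((2 * k).choose k : ℤ)) =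
      n * ∑ k ∈ range (n + 1), (n.choose k : ℤ) ^ 2 * ((2 * k).choose k : ℤ) -
      ∑ k ∈ range (n + 1), (k : ℤ) * ((n.choose k : ℤ) ^ 2 * ((2 * k).choose k : ℤ)) := by
    rw [mul_sum, ← sum_sub_distrib]
    exact sum_congr rfl fun k _ ↦ by ring
  linarith

/-- With `N = n + 1`, `(n+1) C(n,k) = (N-k) C(N,k)` puts every term over `C(N,k)^2 * catalan k`.
Then `(k+1)(2k+1) - (N+1)^2 + (N-k)^2 = (k+1)(3k-2N)` makes the difference of the sides the
first-moment identity, term by term. -/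
theorem sunS_eq_sub (n : ℕ) :
    sunS (n + 1) = ((n : ℤ) + 2) ^ 2 * ∑ k ∈ range (n + 2), ((n + 1).choose k : ℤ) ^ 2 * catalan k -
      ((n : ℤ) + 1) ^ 2 * ∑ k ∈ range (n + 1), (n.choose k : ℤ) ^ 2 * catalan k := by
  have ext : ∑ k ∈ range (n + 1), (n.choose k : ℤ) ^ 2 * (catalan k : ℤ) =
      ∑ k ∈ range (n + 2), (n.choose k : ℤ) ^ 2 * (catalan k : ℤ) := by
    rw [sum_range_succ _ (n + 1)]
    simp
  have key := three_mul_sum_mul_choose_sq (n + 1)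
  rw [ext, mul_sum, mul_sum, ← sum_sub_distrib, sunS, ← sub_eq_zero, ← sum_sub_distrib]
  rw [mul_sum, mul_sum, ← sub_eq_zero, ← sum_sub_distrib] at key
  rw [← key]
  refine sum_congr rfl fun k hk ↦ ?_
  have hk : k ≤ n + 1 := by simpa [Nat.lt_succ_iff] using hk
  have hc : ((2 * k).choose k : ℤ) = (k + 1) * catalan k := by
    exact_mod_cast (succ_mul_catalan_eq_centralBinom k).symm
  have hn : ((n : ℤ) + 1) * n.choose k = (n + 1 - k) * (n + 1).choose k := by
    have := Nat.choose_mul_succ_eq n k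
    zify [hk] at this
    linarith
  have hn2 : ((n : ℤ) + 1) ^ 2 * ((n.choose k : ℤ) ^ 2 * catalan k) =
      ((n + 1 - k) * (n + 1).choose k) ^ 2 * catalan k := by
    rw [← hn]; ring
  rw [hn2, hc]
  push_cast
  ring

theorem sum_sunS (n : ℕ) :
    ∑ k ∈ range (n + 1), sunS k =
      ((n : ℤ) + 1) ^ 2 * ∑ k ∈ range (n + 1), (n.choose k : ℤ) ^ 2 * catalan k := by
  induction n with
  | zero => simp [sunS]
  | succ n ih =>
    rw [sum_range_succ, ih, sunS_eq_sub]
    push_cast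
    ring

/-! ### Part (i): divisibility of the polynomial coefficients by `n`. -/

/-- Vandermonde applied to one factor, with `k = (k-j) + j`. The right side is linear in binomials
of `k`, so it can be summed over `k` by the hockey-stick identity. -/
theorem choose_sq_eq_sum (k j : ℕ) :
    k.choose j ^ 2 = ∑ i ∈ range (j + 1), (j + i).choose j * j.choose i * k.choose (j + i) := by
  rcases lt_or_ge k j with h | h
  · rw [Nat.choose_eq_zero_of_lt h]
    symm
    simp only [ne_eq, OfNat.ofNat_ne_zero, not_false_eq_true, zero_pow]
    exact sum_eq_zero fun i _ ↦ by rw [Nat.choose_eq_zero_of_lt (by omega : k < j + i), mul_zero]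
  · have hv : k.choose j = ∑ i ∈ range (j + 1), (k - j).choose i * j.choose i := by
      conv_lhs => rw [show k = (k - j) + j by omega]
      rw [Nat.add_choose_eq, Nat.sum_antidiagonal_eq_sum_range_succ
        (fun a b ↦ (k - j).choose a * j.choose b)]
      refine sum_congr rfl fun i hi ↦ ?_
      rw [Nat.choose_symm (by simpa [Nat.lt_succ_iff] using hi)]
    rw [sq]
    nth_rewrite 2 [hv]
    rw [mul_sum]
    refine sum_congr rfl fun i _ ↦ ?_
    rcases lt_or_ge k (j + i) with h' | h'
    · rw [Nat.choose_eq_zero_of_lt h', Nat.choose_eq_zero_of_lt (by omega : k - j < i)]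
      ring
    · have := Nat.choose_mul (n := k) (k := j + i) (s := j) (by omega)
      rw [Nat.add_sub_cancel_left] at this
      calc _ = k.choose j * (k - j).choose i * j.choose i := by ring
        _ = _ := by rw [← this]; ring

/-- Extracts the factor `j + i + 1` that `n.choose (j+i+1)` needs in order to release a factor `n`.
-/
theorem central_mul_choose_mul_choose {i j : ℕ} (h : i ≤ j) :
    (2 * j + 1) * (2 * j).choose j * ((j + i).choose j * j.choose i) =
      (j + i + 1) * ((2 * j + 1).choose (j - i) * (j + i).choose j ^ 2) := by
  have h1 := Nat.add_choose_mul_factorial_mul_factorial j j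
  have h2 := Nat.add_choose_mul_factorial_mul_factorial j i
  rw [← Nat.choose_symm_add] at h2
  have h3 := Nat.choose_mul_factorial_mul_factorial h
  have h4 := Nat.choose_mul_factorial_mul_factorial (show j - i ≤ 2 * j + 1 by omega)
  rw [show 2 * j + 1 - (j - i) = j + i + 1 by omega, Nat.factorial_succ, Nat.factorial_succ] at h4
  rw [← two_mul] at h1
  have hj := Nat.factorial_ne_zero j
  have hi := Nat.factorial_ne_zero i
  have hji := Nat.factorial_ne_zero (j - i)
  qify at *
  have e1 : ((2 * j).choose j : ℚ) = (2 * j).factorial / (j.factorial * j.factorial) := by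
    field_simp; linarith
  have e2 : ((j + i).choose j : ℚ) = (j + i).factorial / (j.factorial * i.factorial) := by
    field_simp; linarith
  have e3 : (j.choose i : ℚ) = j.factorial / (i.factorial * (j - i).factorial) := by
    field_simp; linarith
  have hs : ((j + i).factorial : ℚ) ≠ 0 := by positivity
  have hs' : (j : ℚ) + i + 1 ≠ 0 := by positivity
  have e4 : ((2 * j + 1).choose (j - i) : ℚ) =
      (2 * j + 1) * (2 * j).factorial / ((j - i).factorial * ((j + i + 1) * (j + i).factorial)) := by
    field_simp; linarith
  rw [e1, e2, e3, e4]
  field_simp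

theorem central_mul_sum_choose_sq (n j : ℕ) :
    (2 * j + 1) * (2 * j).choose j * ∑ m ∈ range n, m.choose j ^ 2 =
      n * ∑ i ∈ range (j + 1),
        (n - 1).choose (j + i) * ((2 * j + 1).choose (j - i) * (j + i).choose j ^ 2) := by
  have hockey (l : ℕ) : ∑ m ∈ range n, m.choose l = n.choose (l + 1) := by
    induction n with
    | zero => simp
    | succ n ih => rw [sum_range_succ, ih, Nat.choose_succ_succ', add_comm]
  have absorb (l : ℕ) : (l + 1) * n.choose (l + 1) = n * (n - 1).choose l := by
    cases n with
    | zero => simp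
    | succ n => rw [Nat.add_sub_cancel, Nat.add_one_mul_choose_eq, mul_comm]
  rw [sum_congr rfl fun m _ ↦ choose_sq_eq_sum m j, sum_comm, mul_sum, mul_sum]
  refine sum_congr rfl fun i hi ↦ ?_
  rw [← mul_sum, hockey, ← mul_assoc,
    central_mul_choose_mul_choose (by simpa [Nat.lt_succ_iff] using hi), ← mul_assoc n, ← absorb]
  ring

theorem exists_sum_sunSPoly (n : ℕ) :
    ∃ Q : Polynomial ℤ, ∑ k ∈ range n, sunSPoly k = Polynomial.C (n : ℤ) * Q := by
  rw [← dvd_def, Polynomial.C_dvd_iff_dvd_coeff]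
  intro j
  have hc (k : ℕ) : (sunSPoly k).coeff j =
      (((2 * j + 1) * (2 * j).choose j * k.choose j ^ 2 : ℕ) : ℤ) := by
    simp only [sunSPoly, Polynomial.finsetSum_coeff, Polynomial.coeff_C_mul, Polynomial.coeff_X_pow,
      mul_ite, mul_one, mul_zero, sum_ite_eq, mem_range]
    split_ifs with h
    · push_cast; ring
    · rw [Nat.choose_eq_zero_of_lt (by omega : k < j)]; simp
  simp_rw [Polynomial.finsetSum_coeff, hc]
  rw [← Nat.cast_sum, ← mul_sum, central_mul_sum_choose_sq]
  exact Int.natCast_dvd_natCast.mpr (dvd_mul_right _ _)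

theorem sum_sunS_div_sq (n : ℕ) (hn : 1 ≤ n) :
    1 / (n : ℚ) ^ 2 * ∑ k ∈ range n, (sunS k : ℚ) =
      ∑ k ∈ range n, ((n - 1).choose k : ℚ) ^ 2 * (catalan k : ℚ) := by
  obtain ⟨m, rfl⟩ : ∃ m, n = m + 1 := ⟨n - 1, by omega⟩
  have h : ∑ k ∈ range (m + 1), (sunS k : ℚ) =
      ((m : ℚ) + 1) ^ 2 * ∑ k ∈ range (m + 1), (m.choose k : ℚ) ^ 2 * (catalan k : ℚ) := by
    exact_mod_cast sum_sunS m
  have hm : (m : ℚ) + 1 ≠ 0 := by positivity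
  rw [h]
  push_cast
  field_simp

theorem sunS_part_one (n : ℕ) (hn : 1 ≤ n) :
    (1 / (n : ℚ) ^ 2 * ∑ k ∈ Finset.range n, (sunS k : ℚ) =
          ∑ k ∈ Finset.range n, ((n - 1).choose k : ℚ) ^ 2 * (catalan k : ℚ)) ∧
      (∃ z : ℤ, 1 / (n : ℚ) ^ 2 * ∑ k ∈ Finset.range n, (sunS k : ℚ) = (z : ℚ)) ∧
      (∃ Q : Polynomial ℤ,
        Polynomial.C (1 / (n : ℚ)) *
            ∑ k ∈ Finset.range n, (sunSPoly k).map (Int.castRingHom ℚ) =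
          Q.map (Int.castRingHom ℚ)) := by
  refine ⟨sum_sunS_div_sq n hn,
    ⟨∑ k ∈ range n, ((n - 1).choose k : ℤ) ^ 2 * (catalan k : ℤ), ?_⟩, ?_⟩
  · rw [sum_sunS_div_sq n hn]
    push_cast
    rfl
  · obtain ⟨Q, hQ⟩ := exists_sum_sunSPoly n
    refine ⟨Q, ?_⟩
    have hn' : (n : ℚ) ≠ 0 := by positivity
    rw [← Polynomial.map_sum, hQ, Polynomial.map_mul, ← mul_assoc, Polynomial.map_C,
      ← Polynomial.C_mul]
    simp [hn']

/-! ### Calculus of residues of `p`-integral rationals. -/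

/-- `q` is a `p`-integral rational number with residue class `z` modulo `p`. -/
def RatReduces (p : ℕ) (q : ℚ) (z : ZMod p) [Fact p.Prime] : Prop :=
  ∃ (m : ℤ) (d : ℕ), (d : ZMod p) ≠ 0 ∧ q = m / d ∧ z = m / d

namespace RatReduces

variable {p : ℕ} [Fact p.Prime] {a b : ℚ} {x y : ZMod p}

theorem ne_zero_of_cast {d : ℕ} (h : (d : ZMod p) ≠ 0) : (d : ℚ) ≠ 0 := by
  rintro h'
  exact h (by rw [Nat.cast_eq_zero.mp h', Nat.cast_zero])

theorem intCast (m : ℤ) : RatReduces p m m := ⟨m, 1, by simp, by simp, by simp⟩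

theorem natCast (m : ℕ) : RatReduces p m m := by simpa using intCast (p := p) m

theorem zero : RatReduces p 0 0 := by simpa using natCast (p := p) 0

theorem one : RatReduces p 1 1 := by simpa using natCast (p := p) 1

theorem add (ha : RatReduces p a x) (hb : RatReduces p b y) : RatReduces p (a + b) (x + y) := by
  obtain ⟨m, d, hd, rfl, rfl⟩ := ha
  obtain ⟨n, e, he, rfl, rfl⟩ := hb
  have := ne_zero_of_cast hd
  have := ne_zero_of_cast he
  refine ⟨m * e + d * n, d * e, by push_cast; exact mul_ne_zero hd he, ?_, ?_⟩ <;>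
  · push_cast
    rw [div_add_div _ _ (by assumption) (by assumption)]

theorem mul (ha : RatReduces p a x) (hb : RatReduces p b y) : RatReduces p (a * b) (x * y) := by
  obtain ⟨m, d, hd, rfl, rfl⟩ := ha
  obtain ⟨n, e, he, rfl, rfl⟩ := hb
  refine ⟨m * n, d * e, by push_cast; exact mul_ne_zero hd he, ?_, ?_⟩ <;>
  · push_cast
    rw [div_mul_div_comm]

theorem neg (ha : RatReduces p a x) : RatReduces p (-a) (-x) := by
  simpa using (intCast (p := p) (-1)).mul ha

theorem sub (ha : RatReduces p a x) (hb : RatReduces p b y) : RatReduces p (a - b) (x - y) := by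
  simpa [sub_eq_add_neg] using ha.add hb.neg

theorem pow (ha : RatReduces p a x) (n : ℕ) : RatReduces p (a ^ n) (x ^ n) := by
  induction n with
  | zero => simpa using one (p := p)
  | succ n ih => simpa [pow_succ] using ih.mul ha

theorem inv_natCast {d : ℕ} (hd : (d : ZMod p) ≠ 0) :
    RatReduces p (d : ℚ)⁻¹ (d : ZMod p)⁻¹ := ⟨1, d, hd, by simp, by simp⟩

theorem div_natCast (ha : RatReduces p a x) {d : ℕ} (hd : (d : ZMod p) ≠ 0) :
    RatReduces p (a / d) (x / d) := by
  simpa [div_eq_mul_inv] using ha.mul (inv_natCast hd)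

theorem div_natCast_pow (ha : RatReduces p a x) {d : ℕ} (hd : (d : ZMod p) ≠ 0) (n : ℕ) :
    RatReduces p (a / d ^ n) (x / d ^ n) := by
  have := ha.div_natCast (d := d ^ n) (by push_cast; exact pow_ne_zero n hd)
  simpa using this

theorem sum {ι : Type*} {s : Finset ι} {f : ι → ℚ} {g : ι → ZMod p}
    (h : ∀ i ∈ s, RatReduces p (f i) (g i)) : RatReduces p (∑ i ∈ s, f i) (∑ i ∈ s, g i) := by
  classical
  induction s using Finset.induction_on with
  | empty => simpa using zero (p := p)
  | insert i s hi ih =>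
    rw [sum_insert hi, sum_insert hi]
    exact (h i (mem_insert_self i s)).add (ih fun j hj ↦ h j (mem_insert_of_mem hj))

/-- The explicit factor `p` lifts equality of residues modulo `p` to a congruence modulo `p^2`. -/
theorem ratModEq (ha : RatReduces p a x) (hb : RatReduces p b x) :
    RatModEq (p ^ 2) (p * a) (p * b) := by
  have h := ha.sub hb
  rw [sub_self] at h
  obtain ⟨m, d, hd, hq, hz⟩ := h
  have hm : (m : ZMod p) = 0 := by
    rcases div_eq_zero_iff.mp hz.symm with h | h
    · exact h
    · exact absurd h hd
  obtain ⟨c, rfl⟩ := (ZMod.intCast_zmod_eq_zero_iff_dvd m p).mp hm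
  refine ⟨c / d, ?_, ?_⟩
  · have hdvd : ((c : ℚ) / d).den ∣ d := by
      have := Rat.den_dvd c d
      rw [Rat.divInt_eq_div, Int.cast_natCast] at this
      exact_mod_cast this
    refine Nat.Coprime.pow_right 2 (Nat.Coprime.coprime_dvd_left hdvd ?_)
    rw [Nat.coprime_comm, (Fact.out : p.Prime).coprime_iff_not_dvd]
    rwa [Ne, ZMod.natCast_eq_zero_iff] at hd
  · rw [← mul_sub, hq]
    push_cast
    ring

end RatReduces

/-! ### The sums `∑ C(k,j)^2 / k` modulo `p^2`. -/

/-- A creative-telescoping recurrence in `j`, checked by induction on `n`. The `k = 0` terms vanish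
because division by zero gives zero. -/
theorem sum_choose_sq_div_recurrence (j n : ℕ) :
    2 * (2 * j + 1) * (j + 1) * ∑ k ∈ range n, (k.choose (j + 1) : ℚ) ^ 2 / k -
        j ^ 2 * ∑ k ∈ range n, (k.choose j : ℚ) ^ 2 / k =
      (n.choose (j + 1) : ℚ) ^ 2 * ((2 * j + 1) - (j + 1) * (3 * j + 1) / n) := by
  induction n with
  | zero => simp
  | succ n ih =>
    rw [sum_range_succ, sum_range_succ]
    rcases Nat.eq_zero_or_pos n with rfl | hn
    · cases j <;> simp [Nat.choose_eq_zero_of_lt]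
    have h : (n.choose (j + 1) : ℚ) * (j + 1) = n.choose j * (n - j) := by
      rcases le_or_gt j n with h | h
      · have := Nat.choose_succ_right_eq n j
        qify [h] at this
        exact this
      · simp [Nat.choose_eq_zero_of_lt h, Nat.choose_eq_zero_of_lt (by omega : n < j + 1)]
    have hj : (j : ℚ) + 1 ≠ 0 := by positivity
    have hn' : (n : ℚ) ≠ 0 := by positivity
    have hn1 : (n : ℚ) + 1 ≠ 0 := by positivity
    have h' : (n.choose (j + 1) : ℚ) = n.choose j * (n - j) / (j + 1) := by
      field_simp; exact h
    have hs : ((n + 1).choose (j + 1) : ℚ) = n.choose j + n.choose (j + 1) := by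
      exact_mod_cast Nat.choose_succ_succ' n j
    have split : ∀ A B a b : ℚ, 2 * (2 * (j : ℚ) + 1) * (j + 1) * (A + a) - j ^ 2 * (B + b) =
        (2 * (2 * (j : ℚ) + 1) * (j + 1) * A - j ^ 2 * B) +
        (2 * (2 * (j : ℚ) + 1) * (j + 1) * a - j ^ 2 * b) := by intros; ring
    rw [split, ih, hs, h']
    push_cast
    field_simp
    ring

theorem choose_pred_sq {p j : ℕ} [Fact p.Prime] (hj : j < p) :
    ((p - 1).choose j : ZMod p) ^ 2 = 1 := by
  have hp : p.Prime := Fact.out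
  induction j with
  | zero => simp
  | succ j ih =>
    have h := Nat.choose_succ_succ' (p - 1) j
    rw [Nat.sub_add_cancel hp.one_le] at h
    have h0 : (p.choose (j + 1) : ZMod p) = 0 :=
      (ZMod.natCast_eq_zero_iff _ _).mpr (hp.dvd_choose_self (by omega) hj)
    rw [h] at h0
    push_cast at h0
    rw [eq_neg_of_add_eq_zero_right h0, neg_sq, ih (by omega)]

theorem cast_ne_zero_of_lt {p k : ℕ} (h0 : 0 < k) (hk : k < p) : (k : ZMod p) ≠ 0 := by
  rw [Ne, ZMod.natCast_eq_zero_iff]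
  exact Nat.not_dvd_of_pos_of_lt h0 hk

theorem centralBinom_succ_sub (j : ℕ) :
    (Nat.centralBinom (j + 1) : ℚ) = Nat.centralBinom j + catalan j * (3 * j + 1) := by
  have h1 : ((j : ℚ) + 1) * Nat.centralBinom (j + 1) = 2 * (2 * j + 1) * Nat.centralBinom j := by
    exact_mod_cast Nat.succ_mul_centralBinom_succ j
  have h2 : ((j : ℚ) + 1) * catalan j = Nat.centralBinom j := by
    exact_mod_cast succ_mul_catalan_eq_centralBinom j
  have hj : (j : ℚ) + 1 ≠ 0 := by positivity
  refine mul_left_cancel₀ hj ?_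
  rw [h1, ← h2]
  ring

/-- Induction on `j` through the recurrence at `n = p`. There `C(p,j+1) = p C(p-1,j)/(j+1)` and
`C(p-1,j)^2 ≡ 1`, so each step adds `-p * catalan j * (3j+1)` modulo `p^2`. By
`centralBinom_succ_sub` these increments sum to `-p (C(2j,j) - 1)`. -/
theorem exists_sum_choose_sq_div {p : ℕ} [Fact p.Prime] {j : ℕ} (hj : j < p) :
    ∃ u z, RatReduces p u z ∧
      (j : ℚ) ^ 2 * Nat.centralBinom j * ∑ k ∈ range p, (k.choose j : ℚ) ^ 2 / k =
        -p * (Nat.centralBinom j - 1) + p ^ 2 * u := by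
  have hp : p.Prime := Fact.out
  induction j with
  | zero => exact ⟨0, 0, RatReduces.zero, by simp⟩
  | succ j ih =>
    obtain ⟨u, z, hu, h⟩ := ih (by omega)
    obtain ⟨s, hs⟩ : ∃ s : ℤ, ((p - 1).choose j : ℚ) ^ 2 = 1 + p * s := by
      have h1 := choose_pred_sq (p := p) (j := j) (by omega)
      have h2 : ((((p - 1).choose j : ℤ) ^ 2 - 1 : ℤ) : ZMod p) = 0 := by
        push_cast; rw [h1, sub_self]
      obtain ⟨s, hs⟩ := (ZMod.intCast_zmod_eq_zero_iff_dvd _ p).mp h2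
      exact ⟨s, by rw [← sub_eq_iff_eq_add']; exact_mod_cast hs⟩
    have hj0 : ((j + 1 : ℕ) : ZMod p) ≠ 0 := cast_ne_zero_of_lt (by omega) hj
    -- The new remainder collects the old one, the `p^2` term of the recurrence, and the correction
    -- `s` from replacing `C(p-1,j)^2` by 1.
    have hred : RatReduces p (u + Nat.centralBinom j * ((p - 1).choose j) ^ 2 * (2 * j + 1) /
        ((j + 1 : ℕ) : ℚ) ^ 2 - catalan j * (3 * j + 1) * s) _ :=
      (hu.add ((((RatReduces.natCast _).mul ((RatReduces.natCast _).pow 2)).mul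
        (((RatReduces.natCast 2).mul (RatReduces.natCast j)).add
          RatReduces.one)).div_natCast_pow hj0 2)).sub
        (((RatReduces.natCast _).mul (((RatReduces.natCast 3).mul
          (RatReduces.natCast j)).add RatReduces.one)).mul (RatReduces.intCast s))
    refine ⟨_, _, hred, ?_⟩
    have h1 : ((j : ℚ) + 1) * Nat.centralBinom (j + 1) = 2 * (2 * j + 1) * Nat.centralBinom j := by
      exact_mod_cast Nat.succ_mul_centralBinom_succ j
    have h2 : ((j : ℚ) + 1) * catalan j = Nat.centralBinom j := by
      exact_mod_cast succ_mul_catalan_eq_centralBinom j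
    have hjq : (j : ℚ) + 1 ≠ 0 := by positivity
    have hpq : (p : ℚ) ≠ 0 := by exact_mod_cast hp.ne_zero
    have h3 : (p.choose (j + 1) : ℚ) = p * (p - 1).choose j / (j + 1) := by
      have := Nat.add_one_mul_choose_eq (p - 1) j
      rw [Nat.sub_add_cancel hp.one_le] at this
      have : (p : ℚ) * (p - 1).choose j = p.choose (j + 1) * (j + 1) := by exact_mod_cast this
      rw [this]; field_simp
    have hrec := sum_choose_sq_div_recurrence j p
    rw [h3] at hrec
    have e : (((j + 1 : ℕ) : ℚ)) ^ 2 * Nat.centralBinom (j + 1) *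
        ∑ k ∈ range p, (k.choose (j + 1) : ℚ) ^ 2 / k =
        Nat.centralBinom j * (2 * (2 * j + 1) * (j + 1) *
          ∑ k ∈ range p, (k.choose (j + 1) : ℚ) ^ 2 / k) := by
      push_cast
      linear_combination ((j : ℚ) + 1) * (∑ k ∈ range p, (k.choose (j + 1) : ℚ) ^ 2 / k) * h1
    rw [e, eq_add_of_sub_eq hrec, mul_add, centralBinom_succ_sub]
    have e2 : (Nat.centralBinom j : ℚ) * (j ^ 2 * ∑ k ∈ range p, (k.choose j : ℚ) ^ 2 / k) =
        -p * (Nat.centralBinom j - 1) + p ^ 2 * u := by rw [← h]; ring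
    rw [e2, ← h2, div_pow, mul_pow]
    push_cast
    rw [hs]
    field_simp
    ring

/-! ### Finite polylogarithms over `𝔽_p`. -/

section
open Polynomial

/-- In characteristic `p` a polynomial identity can be checked on derivatives and one value once
degrees are below `p`; this is how both polylogarithm identities are proved. -/
theorem Polynomial.eq_C_of_derivative_eq_zero_of_natDegree_lt {p : ℕ} {R : Type*} [CommRing R]
    [IsDomain R] [CharP R p] {q : R[X]} (hq : derivative q = 0) (hd : q.natDegree < p) :
    q = C (q.coeff 0) := by
  ext n
  rw [coeff_C]
  split_ifs with h
  · rw [h]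
  · obtain ⟨m, rfl⟩ := Nat.exists_eq_succ_of_ne_zero h
    by_contra hne
    have h1 := le_natDegree_of_ne_zero hne
    have h2 : (derivative q).coeff m = 0 := by rw [hq, coeff_zero]
    rw [coeff_derivative] at h2
    rcases mul_eq_zero.mp h2 with h3 | h3
    · exact hne h3
    · have h4 : ((m + 1 : ℕ) : R) = 0 := by exact_mod_cast h3
      rw [CharP.cast_eq_zero_iff R p] at h4
      exact absurd (Nat.le_of_dvd (by omega) h4) (by omega)

section
variable {p : ℕ} [Fact p.Prime]

/-- This is `C(2k,k) = (-4)^k C(-1/2,k)`, with `p / 2 = (p-1)/2 ≡ -1/2`. -/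
theorem centralBinom_eq_choose_half (hp : p ≠ 2) {k : ℕ} (hk : k < p) :
    (Nat.centralBinom k : ZMod p) = ((p / 2).choose k : ZMod p) * (-4) ^ k := by
  have hodd : p % 2 = 1 := (Fact.out : p.Prime).mod_two_eq_one_iff_ne_two.mpr hp
  induction k with
  | zero => simp
  | succ k ih =>
    have h0 : ((k + 1 : ℕ) : ZMod p) ≠ 0 := cast_ne_zero_of_lt (by omega) hk
    push_cast at h0
    have h1 : ((k : ZMod p) + 1) * Nat.centralBinom (k + 1) =
        2 * (2 * k + 1) * Nat.centralBinom k := by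
      exact_mod_cast congrArg (Nat.cast : ℕ → ZMod p) (Nat.succ_mul_centralBinom_succ k)
    have h2 : ((p / 2).choose (k + 1) : ZMod p) * (k + 1) = (p / 2).choose k * ((p / 2 : ℕ) - k) := by
      rcases le_or_gt k (p / 2) with h | h
      · have := congrArg (Nat.cast : ℕ → ZMod p) (Nat.choose_succ_right_eq (p / 2) k)
        push_cast [h] at this
        exact this
      · simp [Nat.choose_eq_zero_of_lt h, Nat.choose_eq_zero_of_lt (by omega : p / 2 < k + 1)]
    have h3 : 2 * ((p / 2 : ℕ) : ZMod p) + 1 = 0 := by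
      have h : 2 * (p / 2) + 1 = p := by omega
      have := congrArg (Nat.cast : ℕ → ZMod p) h
      simpa using this
    refine mul_left_cancel₀ h0 ?_
    rw [h1, ih (by omega), pow_succ]
    linear_combination (-(-4) ^ k * (-4)) * h2 + 2 * (p / 2).choose k * (-4) ^ k * h3

/-- `∑_{k=1}^{p-1} X^k / k^s` over `𝔽_p`. -/
noncomputable def finitePolylog (p s : ℕ) [Fact p.Prime] : (ZMod p)[X] :=
  ∑ k ∈ Icc 1 (p - 1), C (((k : ZMod p) ^ s)⁻¹) * X ^ k

/-- `∑_{k=1}^{p-1} (2k choose k) T^k / k^s` over `𝔽_p`, evaluated at `T = X (1 - X)`. -/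
noncomputable def centralPolylog (p s : ℕ) [Fact p.Prime] : (ZMod p)[X] :=
  ∑ k ∈ Icc 1 (p - 1), C ((Nat.centralBinom k : ZMod p) / (k : ZMod p) ^ s) * (X * (1 - X)) ^ k

theorem cast_ne_zero_of_mem_Icc {k : ℕ} (hk : k ∈ Icc 1 (p - 1)) : (k : ZMod p) ≠ 0 := by
  have := (Fact.out : p.Prime).one_lt
  rw [mem_Icc] at hk
  exact cast_ne_zero_of_lt (by omega) (by omega)

theorem X_mul_derivative_finitePolylog (s : ℕ) :
    X * derivative (finitePolylog p (s + 1)) = finitePolylog p s := by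
  simp only [finitePolylog, derivative_sum, mul_sum]
  refine sum_congr rfl fun k hk ↦ ?_
  have h0 := cast_ne_zero_of_mem_Icc hk
  obtain ⟨m, rfl⟩ : ∃ m, k = m + 1 := ⟨k - 1, by rw [mem_Icc] at hk; omega⟩
  rw [derivative_C_mul, derivative_X_pow, Nat.add_sub_cancel]
  have : ((↑(m + 1) : ZMod p) ^ s)⁻¹ = ((↑(m + 1) : ZMod p) ^ (s + 1))⁻¹ * (m + 1 : ℕ) := by
    field_simp
    ring
  rw [this, C_mul]
  ring

theorem X_mul_derivative_centralPolylog (s : ℕ) :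
    X * (1 - X) * derivative (centralPolylog p (s + 1)) = (1 - 2 * X) * centralPolylog p s := by
  simp only [centralPolylog, derivative_sum, mul_sum]
  refine sum_congr rfl fun k hk ↦ ?_
  have h0 := cast_ne_zero_of_mem_Icc hk
  obtain ⟨m, rfl⟩ : ∃ m, k = m + 1 := ⟨k - 1, by rw [mem_Icc] at hk; omega⟩
  rw [derivative_C_mul, derivative_pow, Nat.add_sub_cancel]
  have : (Nat.centralBinom (m + 1) : ZMod p) / (↑(m + 1) : ZMod p) ^ s =
      (Nat.centralBinom (m + 1) : ZMod p) / (↑(m + 1) : ZMod p) ^ (s + 1) * (m + 1 : ℕ) := by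
    field_simp
    ring
  rw [this, C_mul]
  simp only [derivative_mul, derivative_sub, derivative_one, derivative_X]
  ring

theorem natDegree_finitePolylog_le (s : ℕ) : (finitePolylog p s).natDegree ≤ p - 1 := by
  refine natDegree_sum_le_of_forall_le _ _ fun k hk ↦ ?_
  refine (natDegree_C_mul_X_pow_le _ _).trans ?_
  rw [mem_Icc] at hk
  omega

theorem natDegree_one_sub_X_le : (1 - X : (ZMod p)[X]).natDegree ≤ 1 :=
  (natDegree_sub_le _ _).trans (by simp)

/-- The apparent degree `2(p-1)` drops because `C(2k,k)` vanishes modulo `p` for `p/2 < k < p`. -/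
theorem natDegree_centralPolylog_le (hp : p ≠ 2) (s : ℕ) :
    (centralPolylog p s).natDegree ≤ p - 1 := by
  refine natDegree_sum_le_of_forall_le _ _ fun k hk ↦ ?_
  rw [mem_Icc] at hk
  rcases le_or_gt k (p / 2) with h | h
  · refine (natDegree_C_mul_le _ _).trans ?_
    refine natDegree_pow_le.trans ?_
    have : (X * (1 - X) : (ZMod p)[X]).natDegree ≤ 2 :=
      natDegree_mul_le.trans (add_le_add natDegree_X_le natDegree_one_sub_X_le)
    have hodd : p % 2 = 1 := (Fact.out : p.Prime).mod_two_eq_one_iff_ne_two.mpr hp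
    calc _ ≤ k * 2 := Nat.mul_le_mul_left k this
      _ ≤ _ := by omega
  · rw [centralBinom_eq_choose_half hp (by omega), Nat.choose_eq_zero_of_lt h]
    simp

/-- Binomial theorem for `(1 - 4X(1-X))^((p-1)/2)`, whose base is `(1-2X)^2`. -/
theorem centralPolylog_zero (hp : p ≠ 2) :
    centralPolylog p 0 = (1 - 2 * X) ^ (p - 1) - 1 := by
  have hodd : p % 2 = 1 := (Fact.out : p.Prime).mod_two_eq_one_iff_ne_two.mpr hp
  have h1 : p - 1 = 2 * (p / 2) := by omega
  have h2 : (1 - 2 * X : (ZMod p)[X]) ^ (p - 1) = (-4 * (X * (1 - X)) + 1) ^ (p / 2) := by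
    rw [h1, pow_mul]; ring
  rw [h2, add_pow, centralPolylog]
  have h3 : range (p / 2 + 1) = insert 0 (Icc 1 (p / 2)) := by ext; simp; omega
  rw [h3, sum_insert (by simp)]
  simp only [pow_zero, one_pow, mul_one, Nat.choose_zero_right, Nat.cast_one, div_one,
    add_sub_cancel_left]
  rw [← sum_subset (Icc_subset_Icc_right (show p / 2 ≤ p - 1 by omega))]
  · refine sum_congr rfl fun k hk ↦ ?_
    rw [mem_Icc] at hk
    rw [centralBinom_eq_choose_half hp (by omega), mul_pow (-4)]
    simp only [C_mul, C_pow, C_neg, map_natCast, map_ofNat]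
    ring
  · intro k hk hk'
    rw [mem_Icc] at hk hk'
    rw [centralBinom_eq_choose_half hp (by omega), Nat.choose_eq_zero_of_lt (by omega)]
    simp

theorem one_sub_X_mul_finitePolylog_zero : (1 - X) * finitePolylog p 0 = X - X ^ p := by
  have hp := (Fact.out : p.Prime).one_lt
  have h : finitePolylog p 0 = X * ∑ i ∈ range (p - 1), X ^ i := by
    rw [finitePolylog, mul_sum]
    refine sum_nbij' (· - 1) (· + 1) ?_ ?_ ?_ ?_ ?_
    all_goals intro k hk; simp only [mem_Icc, mem_range] at hk ⊢
    · omega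
    · omega
    · omega
    · omega
    · rw [← pow_succ', Nat.sub_add_cancel hk.1]
      simp
  rw [h, mul_left_comm, mul_neg_geom_sum, mul_sub, mul_one, ← pow_succ', Nat.sub_add_cancel hp.le]

theorem centralPolylog_one (hp : p ≠ 2) : centralPolylog p 1 = 2 * finitePolylog p 1 := by
  have hp1 := (Fact.out : p.Prime).one_lt
  have hX : (X * (1 - X) : (ZMod p)[X]) ≠ 0 := by
    refine mul_ne_zero X_ne_zero fun h ↦ ?_
    have := congrArg (eval 0) h
    simp at this
  have hd : derivative (centralPolylog p 1 - 2 * finitePolylog p 1) = 0 := by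
    refine (mul_eq_zero.mp ?_).resolve_left hX
    have h1 := X_mul_derivative_centralPolylog (p := p) 0
    have h2 := X_mul_derivative_finitePolylog (p := p) 0
    have h3 := one_sub_X_mul_finitePolylog_zero (p := p)
    rw [zero_add] at h1 h2
    -- Frobenius together with `2^p = 2` in `𝔽_p`; the right side is `2(1-X) £_0`.
    have h4 : (1 - 2 * X : (ZMod p)[X]) * ((1 - 2 * X) ^ (p - 1) - 1) = 2 * (X - X ^ p) := by
      rw [mul_sub, ← pow_succ', Nat.sub_add_cancel hp1.le, sub_pow_char, mul_pow, one_pow]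
      have : (2 : (ZMod p)[X]) ^ p = 2 := by
        rw [show (2 : (ZMod p)[X]) = C 2 from (map_ofNat C 2).symm, ← C_pow, ZMod.pow_card]
      rw [this]
      ring
    rw [derivative_sub, mul_sub, h1, centralPolylog_zero hp, h4, ← h3, ← h2,
      show (2 : (ZMod p)[X]) = C 2 from (map_ofNat C 2).symm, derivative_C_mul]
    ring
  have hdeg : (centralPolylog p 1 - 2 * finitePolylog p 1).natDegree < p := by
    refine lt_of_le_of_lt ((natDegree_sub_le_of_le (natDegree_centralPolylog_le hp 1) (?_ :
      _ ≤ p - 1))) (by simp; omega)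
    rw [show (2 : (ZMod p)[X]) = C 2 from (map_ofNat C 2).symm]
    exact (natDegree_C_mul_le _ _).trans (natDegree_finitePolylog_le 1)
  have h := eq_C_of_derivative_eq_zero_of_natDegree_lt hd hdeg
  rw [← sub_eq_zero, h, coeff_zero_eq_eval_zero, eval_sub, eval_mul]
  have e1 : eval 0 (centralPolylog p 1) = 0 := by
    rw [centralPolylog, eval_finsetSum]
    exact sum_eq_zero fun k hk ↦ by
      have : k ≠ 0 := by rw [mem_Icc] at hk; omega
      simp [this]
  have e2 : eval 0 (finitePolylog p 1) = 0 := by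
    rw [finitePolylog, eval_finsetSum]
    exact sum_eq_zero fun k hk ↦ by
      have : k ≠ 0 := by rw [mem_Icc] at hk; omega
      simp [this]
  simp [e1, e2]

end

end

/-! ### Evaluation at a primitive sixth root of unity, and sums over classes modulo 3. -/

section
open Polynomial

/-- The trace of `ω ^ a` for a primitive cube root of unity `ω`, as an element of `𝔽_p`. -/
def cubeTrace (p : ℕ) (a : ZMod 3) : ZMod p := if a = 0 then 2 else -1

theorem cubeTrace_neg {p : ℕ} (a : ZMod 3) : cubeTrace p (-a) = cubeTrace p a := by
  simp [cubeTrace]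

theorem cubeTrace_add_add {p : ℕ} {b : ZMod 3} (hb : b ≠ 0) (a : ZMod 3) :
    cubeTrace p a + cubeTrace p (a + b) + cubeTrace p (a - b) = 0 := by
  have h : (a = 0 ∧ a + b ≠ 0 ∧ a - b ≠ 0) ∨ (a ≠ 0 ∧ a + b = 0 ∧ a - b ≠ 0) ∨
      (a ≠ 0 ∧ a + b ≠ 0 ∧ a - b = 0) := by
    revert a b; decide
  unfold cubeTrace
  rcases h with ⟨h1, h2, h3⟩ | ⟨h1, h2, h3⟩ | ⟨h1, h2, h3⟩
  · rw [if_pos h1, if_neg h2, if_neg h3]; ring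
  · rw [if_neg h1, if_pos h2, if_neg h3]; ring
  · rw [if_neg h1, if_neg h2, if_pos h3]; ring

section
variable {p : ℕ} [Fact p.Prime]

/-- Reindexing by `k = 2m mod p`: even `k` is `2m` and odd `k` is `2m - p`. As `2 = -1` modulo 3,
`m` is `-k` or `-k - p` there. -/
theorem sum_div_pow_double (hp : p ≠ 2) (F : ZMod 3 → ZMod p) (s : ℕ) :
    ∑ m ∈ Icc 1 (p - 1), F m / (m : ZMod p) ^ s =
      2 ^ s * ∑ k ∈ Icc 1 (p - 1), (if Even k then F (-k) else F (-k - p)) / (k : ZMod p) ^ s := by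
  have hodd : p % 2 = 1 := (Fact.out : p.Prime).mod_two_eq_one_iff_ne_two.mpr hp
  have h3 : (3 : ZMod 3) = 0 := rfl
  have h2 : (2 : ZMod p) ≠ 0 := by
    exact_mod_cast cast_ne_zero_of_lt (p := p) (k := 2) (by omega)
      (by have := (Fact.out : p.Prime).two_le; omega)
  rw [mul_sum]
  refine sum_nbij' (fun m ↦ if 2 * m < p then 2 * m else 2 * m - p)
    (fun k ↦ if Even k then k / 2 else (k + p) / 2) ?_ ?_ ?_ ?_ ?_
  · intro m hm
    simp only [mem_Icc] at hm ⊢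
    split_ifs <;> omega
  · intro k hk
    simp only [mem_Icc, Nat.even_iff] at hk ⊢
    split_ifs <;> omega
  · intro m hm
    simp only [mem_Icc, Nat.even_iff] at hm ⊢
    split_ifs <;> omega
  · intro k hk
    simp only [mem_Icc, Nat.even_iff] at hk ⊢
    split_ifs <;> omega
  · intro m hm
    simp only [mem_Icc] at hm
    have hm0 : (m : ZMod p) ≠ 0 := cast_ne_zero_of_lt (by omega) (by omega)
    by_cases h : 2 * m < p
    · simp only [h, if_true, even_two_mul]
      have : -((2 * m : ℕ) : ZMod 3) = m := by
        push_cast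
        linear_combination (-(m : ZMod 3)) * h3
      rw [this]
      push_cast
      rw [mul_pow]
      field_simp
    · have ho : ¬ Even (2 * m - p) := by rw [Nat.even_iff]; omega
      simp only [h, if_false, ho]
      have : -((2 * m - p : ℕ) : ZMod 3) - p = m := by
        rw [Nat.cast_sub (by omega)]
        push_cast
        linear_combination (-(m : ZMod 3)) * h3
      rw [this, Nat.cast_sub (by omega)]
      push_cast
      rw [CharP.cast_eq_zero (ZMod p) p, sub_zero, mul_pow]
      field_simp

theorem sum_odd_div_pow_reflect (hp : p ≠ 2) (F : ZMod 3 → ZMod p) (s : ℕ) :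
    ∑ k ∈ Icc 1 (p - 1) with ¬ Even k, F k / (k : ZMod p) ^ s =
      (-1) ^ s * ∑ k ∈ Icc 1 (p - 1) with Even k, F (p - k) / (k : ZMod p) ^ s := by
  have hodd : p % 2 = 1 := (Fact.out : p.Prime).mod_two_eq_one_iff_ne_two.mpr hp
  rw [mul_sum]
  refine sum_nbij' (p - ·) (p - ·) ?_ ?_ ?_ ?_ ?_
  all_goals intro k hk; simp only [mem_filter, mem_Icc, Nat.even_iff] at hk ⊢
  · omega
  · omega
  · omega
  · omega
  · have hk0 : (k : ZMod p) ≠ 0 := cast_ne_zero_of_lt (by omega) (by omega)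
    rw [Nat.cast_sub (by omega), Nat.cast_sub (by omega), CharP.cast_eq_zero (ZMod p) p, zero_sub,
      sub_sub_cancel, neg_pow (k : ZMod p)]
    have : ((-1 : ZMod p)) ^ s * (-1) ^ s = 1 := by rw [← mul_pow]; simp
    have h1 : ((-1 : ZMod p)) ^ s ≠ 0 := left_ne_zero_of_mul_eq_one this
    field_simp

theorem sum_inv_eq_zero (hp : p ≠ 2) :
    ∑ k ∈ Icc 1 (p - 1), 1 / (k : ZMod p) = 0 := by
  have h := sum_div_pow_double hp (fun _ ↦ 1) 1
  simp only [pow_one, ite_self] at h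
  linear_combination -h

theorem three_ne_zero_of_lt (hp : 3 < p) : (3 : ZMod p) ≠ 0 := by
  exact_mod_cast cast_ne_zero_of_lt (p := p) (k := 3) (by omega) hp

theorem two_ne_zero_of_lt (hp : 3 < p) : (2 : ZMod p) ≠ 0 := by
  exact_mod_cast cast_ne_zero_of_lt (p := p) (k := 2) (by omega) (by omega)

theorem sum_inv_sq_eq_zero (hp : 3 < p) :
    ∑ k ∈ Icc 1 (p - 1), 1 / (k : ZMod p) ^ 2 = 0 := by
  have h := sum_div_pow_double (by omega : p ≠ 2) (fun _ ↦ 1) 2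
  simp only [ite_self] at h
  have h3 := three_ne_zero_of_lt hp
  refine (mul_eq_zero.mp ?_).resolve_left h3
  linear_combination -h

theorem cast_zmod_three_ne_zero (hp : 3 < p) : (p : ZMod 3) ≠ 0 := by
  rw [Ne, ZMod.natCast_eq_zero_iff]
  intro h
  have := (Nat.prime_dvd_prime_iff_eq Nat.prime_three (Fact.out : p.Prime)).mp h
  omega

/-- The part of `∑ F k / k ^ s` with even (or odd) `k`. -/
def evenSum (p s : ℕ) [Fact p.Prime] (F : ZMod 3 → ZMod p) : ZMod p :=
  ∑ k ∈ Icc 1 (p - 1) with Even k, F k / (k : ZMod p) ^ s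

def oddSum (p s : ℕ) [Fact p.Prime] (F : ZMod 3 → ZMod p) : ZMod p :=
  ∑ k ∈ Icc 1 (p - 1) with ¬ Even k, F k / (k : ZMod p) ^ s

theorem evenSum_add_oddSum (s : ℕ) (F : ZMod 3 → ZMod p) :
    evenSum p s F + oddSum p s F = ∑ k ∈ Icc 1 (p - 1), F k / (k : ZMod p) ^ s :=
  sum_filter_add_sum_filter_not _ _ _

/-- Reflection `k ↦ p - k`, doubling modulo `p`, and the vanishing of the trace over three distinct
classes give two linear relations among the even sum, the odd sum and one auxiliary `E'`.
Eliminating `E'` fixes the ratio of even to odd sum for `s = 1` and `s = 2`. -/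
theorem cubeTrace_sum_relations (hp : 3 < p) (s : ℕ) :
    ∃ E' : ZMod p,
      oddSum p s (cubeTrace p) = (-1) ^ s * E' ∧
      evenSum p s (cubeTrace p) + oddSum p s (cubeTrace p) =
        2 ^ s * (evenSum p s (cubeTrace p) -
          (-1) ^ s * (evenSum p s (cubeTrace p) + E')) := by
  have hp2 : p ≠ 2 := by omega
  have hp3 := cast_zmod_three_ne_zero hp
  have h3 : (3 : ZMod 3) = 0 := rfl
  have hsum : evenSum p s (cubeTrace p) + evenSum p s (fun a ↦ cubeTrace p (a - p)) =
      - evenSum p s (fun a ↦ cubeTrace p (a + p)) := by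
    rw [← add_eq_zero_iff_eq_neg, evenSum, evenSum, evenSum, ← sum_add_distrib, ← sum_add_distrib]
    refine sum_eq_zero fun k _ ↦ ?_
    rw [← add_div, ← add_div, add_right_comm, cubeTrace_add_add hp3, zero_div]
  refine ⟨evenSum p s (fun a ↦ cubeTrace p (a - p)), ?_, ?_⟩
  · rw [oddSum, sum_odd_div_pow_reflect hp2, evenSum]
    simp only [← neg_sub (p : ZMod 3), cubeTrace_neg]
  · have hodd : oddSum p s (fun a ↦ cubeTrace p (a + p)) =
        (-1) ^ s * evenSum p s (fun a ↦ cubeTrace p (a + p)) := by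
      rw [oddSum, sum_odd_div_pow_reflect hp2 (fun a ↦ cubeTrace p (a + p)), evenSum]
      congr 1
      refine sum_congr rfl fun k _ ↦ ?_
      rw [← cubeTrace_neg ((k : ZMod 3) + p)]
      congr 2
      linear_combination (p : ZMod 3) * h3
    rw [hsum, mul_neg, sub_neg_eq_add, ← hodd, evenSum_add_oddSum, sum_div_pow_double hp2]
    congr 1
    rw [← sum_filter_add_sum_filter_not _ (fun k ↦ Even k), evenSum, oddSum]
    congr 1
    · refine sum_congr rfl fun k hk ↦ ?_
      rw [if_pos (mem_filter.mp hk).2, cubeTrace_neg]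
    · refine sum_congr rfl fun k hk ↦ ?_
      rw [if_neg (mem_filter.mp hk).2, ← cubeTrace_neg, neg_sub, sub_neg_eq_add, add_comm]

theorem evenSum_cubeTrace_one (hp : 3 < p) :
    evenSum p 1 (cubeTrace p) = oddSum p 1 (cubeTrace p) := by
  obtain ⟨E', h1, h2⟩ := cubeTrace_sum_relations hp 1
  refine mul_left_cancel₀ (three_ne_zero_of_lt hp) ?_
  linear_combination (-1 : ZMod p) * h2 - 2 * h1

theorem evenSum_cubeTrace_two (hp : 3 < p) :
    evenSum p 2 (cubeTrace p) = -5 * oddSum p 2 (cubeTrace p) := by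
  obtain ⟨E', h1, h2⟩ := cubeTrace_sum_relations hp 2
  linear_combination h2 + 4 * h1

theorem sum_neg_one_pow_mul_cubeTrace (s : ℕ) :
    ∑ k ∈ Icc 1 (p - 1), (-1) ^ k * cubeTrace p k / (k : ZMod p) ^ s =
      evenSum p s (cubeTrace p) - oddSum p s (cubeTrace p) := by
  rw [← sum_filter_add_sum_filter_not _ (fun k ↦ Even k), evenSum, oddSum, sub_eq_add_neg,
    ← sum_neg_distrib]
  congr 1
  · refine sum_congr rfl fun k hk ↦ ?_
    rw [(mem_filter.mp hk).2.neg_one_pow, one_mul]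
  · refine sum_congr rfl fun k hk ↦ ?_
    rw [(Nat.not_even_iff_odd.mp (mem_filter.mp hk).2).neg_one_pow]
    ring

/-- The trace is `3 · [3 ∣ k] - 1`, and `∑ 1/k^2 = 0`, so only the multiples `k = 3m` remain. -/
theorem sum_cubeTrace_div_sq (hp : 3 < p) :
    3 * ∑ k ∈ Icc 1 (p - 1), cubeTrace p k / (k : ZMod p) ^ 2 =
      ∑ m ∈ Icc 1 (p / 3), 1 / (m : ZMod p) ^ 2 := by
  have h3 := three_ne_zero_of_lt hp
  have hp3 : ¬ 3 ∣ p := by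
    rw [← ZMod.natCast_eq_zero_iff]
    exact cast_zmod_three_ne_zero hp
  have h1 : ∑ k ∈ Icc 1 (p - 1), cubeTrace p k / (k : ZMod p) ^ 2 =
      ∑ k ∈ Icc 1 (p - 1) with 3 ∣ k, 3 * (1 / (k : ZMod p) ^ 2) -
        ∑ k ∈ Icc 1 (p - 1), 1 / (k : ZMod p) ^ 2 := by
    rw [sum_filter, ← sum_sub_distrib]
    refine sum_congr rfl fun k _ ↦ ?_
    simp only [cubeTrace, ZMod.natCast_eq_zero_iff]
    split_ifs <;> ring
  rw [h1, sum_inv_sq_eq_zero hp, sub_zero, mul_sum]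
  refine sum_nbij' (· / 3) (3 * ·) ?_ ?_ ?_ ?_ ?_
  all_goals intro k hk; simp only [mem_filter, mem_Icc] at hk ⊢
  · omega
  · omega
  · omega
  · omega
  · obtain ⟨m, rfl⟩ := hk.2
    have hm : (m : ZMod p) ≠ 0 := cast_ne_zero_of_lt (by omega) (by omega)
    rw [Nat.mul_div_cancel_left _ (by omega)]
    push_cast
    field_simp

/-- `2 £_1` equals a polynomial in `X(1-X)`, which is symmetric under `X ↦ 1 - X`. -/
theorem finitePolylog_one_comp (hp : 3 < p) :
    (finitePolylog p 1).comp (1 - X) = finitePolylog p 1 := by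
  have h2 : (2 : (ZMod p)[X]) ≠ 0 := by
    rw [show (2 : (ZMod p)[X]) = C 2 from (map_ofNat C 2).symm, Ne, C_eq_zero]
    exact two_ne_zero_of_lt hp
  refine mul_left_cancel₀ h2 ?_
  have h := centralPolylog_one (p := p) (by omega)
  have hsymm : (centralPolylog p 1).comp (1 - X) = centralPolylog p 1 := by
    simp only [centralPolylog, Polynomial.sum_comp, mul_comp, C_comp, pow_comp, X_comp, sub_comp,
      one_comp, sub_sub_cancel]
    exact sum_congr rfl fun k _ ↦ by ring
  rw [← h, ← hsymm, h, mul_comp]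
  simp

theorem centralPolylog_two (hp : 3 < p) :
    centralPolylog p 2 = 2 * (finitePolylog p 2 + (finitePolylog p 2).comp (1 - X)) := by
  have hX : (X * (1 - X) : (ZMod p)[X]) ≠ 0 := by
    refine mul_ne_zero X_ne_zero fun h ↦ ?_
    have := congrArg (eval 0) h
    simp at this
  have h2C : (2 : (ZMod p)[X]) = C 2 := (map_ofNat C 2).symm
  have hd : derivative (centralPolylog p 2 -
      2 * (finitePolylog p 2 + (finitePolylog p 2).comp (1 - X))) = 0 := by
    refine (mul_eq_zero.mp ?_).resolve_left hX
    have h1 := X_mul_derivative_centralPolylog (p := p) 1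
    have h2 := X_mul_derivative_finitePolylog (p := p) 1
    have h3 := congrArg (fun q : (ZMod p)[X] ↦ q.comp (1 - X)) h2
    simp only [mul_comp, X_comp, finitePolylog_one_comp hp] at h3
    rw [centralPolylog_one (by omega)] at h1
    simp only [Nat.reduceAdd] at h1 h2 h3
    rw [derivative_sub, mul_sub, h1, h2C, derivative_C_mul, derivative_add, derivative_comp,
      ← h2C]
    simp only [derivative_sub, derivative_one, derivative_X]
    linear_combination (-2 * (1 - X : (ZMod p)[X])) * h2 + 2 * X * h3
  have hdeg : (centralPolylog p 2 -
      2 * (finitePolylog p 2 + (finitePolylog p 2).comp (1 - X))).natDegree < p := by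
    refine lt_of_le_of_lt (natDegree_sub_le_of_le (natDegree_centralPolylog_le (by omega) 2) (?_ :
      _ ≤ p - 1)) (by simp; omega)
    rw [h2C]
    refine (natDegree_C_mul_le _ _).trans (natDegree_add_le_of_degree_le
      (natDegree_finitePolylog_le 2) (natDegree_comp_le.trans ?_))
    calc _ ≤ (p - 1) * 1 := Nat.mul_le_mul (natDegree_finitePolylog_le 2) natDegree_one_sub_X_le
      _ = p - 1 := mul_one _
  have h := eq_C_of_derivative_eq_zero_of_natDegree_lt hd hdeg
  rw [← sub_eq_zero, h, coeff_zero_eq_eval_zero, eval_sub, eval_mul]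
  have e1 : eval 0 (centralPolylog p 2) = 0 := by
    rw [centralPolylog, eval_finsetSum]
    exact sum_eq_zero fun k hk ↦ by
      have : k ≠ 0 := by rw [mem_Icc] at hk; omega
      simp [this]
  have e2 : eval 0 (finitePolylog p 2) = 0 := by
    rw [finitePolylog, eval_finsetSum]
    exact sum_eq_zero fun k hk ↦ by
      have : k ≠ 0 := by rw [mem_Icc] at hk; omega
      simp [this]
  have e3 : eval 1 (finitePolylog p 2) = 0 := by
    rw [finitePolylog, eval_finsetSum, ← sum_inv_sq_eq_zero hp]
    exact sum_congr rfl fun k _ ↦ by simp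
  simp [e1, e2, e3]

/-- Here `x` and `1 - x` are `-ω` and `-ω⁻¹` for a primitive cube root of unity `ω`. -/
theorem pow_add_pow_eq_cubeTrace {K : Type*} [Field K] [Algebra (ZMod p) K] {x : K}
    (hx : x * (1 - x) = 1) (k : ℕ) :
    x ^ k + (1 - x) ^ k = algebraMap (ZMod p) K ((-1) ^ k * cubeTrace p k) := by
  have hx2 : x ^ 2 = x - 1 := by linear_combination -hx
  have hx3 : x ^ 3 = -1 := by linear_combination (x + 1) * hx2
  have hy3 : (1 - x) ^ 3 = -1 := by linear_combination (2 - x) * hx2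
  obtain ⟨q, r, hr, rfl⟩ : ∃ q r, r < 3 ∧ k = 3 * q + r :=
    ⟨k / 3, k % 3, Nat.mod_lt _ (by omega), (Nat.div_add_mod k 3).symm⟩
  have hc : ((3 * q + r : ℕ) : ZMod 3) = r := by
    push_cast
    rw [show (3 : ZMod 3) = 0 from rfl, zero_mul, zero_add]
  have hs : ((-1 : ZMod p)) ^ 3 = -1 := by norm_num
  rw [hc, pow_add, pow_add, pow_add, pow_mul, pow_mul, pow_mul, hx3, hy3, hs, ← mul_add, mul_assoc,
    map_mul, map_pow, map_neg, map_one]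
  congr 1
  interval_cases r
  · simp only [cubeTrace, pow_zero, one_mul, Nat.cast_zero, if_true, map_ofNat]
    norm_num
  · have : (1 : ZMod 3) ≠ 0 := by decide
    simp [cubeTrace]
  · have : (2 : ZMod 3) ≠ 0 := by decide
    simp [cubeTrace, this]
    linear_combination 2 * hx2

theorem exists_mul_one_sub_eq_one (hp : 3 < p) :
    ∃ x : AlgebraicClosure (ZMod p), x * (1 - x) = 1 := by
  obtain ⟨z, hz⟩ := IsAlgClosed.exists_pow_nat_eq (-3 : AlgebraicClosure (ZMod p)) (n := 2)
    (by omega)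
  have h2 : (2 : AlgebraicClosure (ZMod p)) ≠ 0 := by
    have := (map_ne_zero (algebraMap (ZMod p) (AlgebraicClosure (ZMod p)))).mpr
      (two_ne_zero_of_lt hp)
    rwa [map_ofNat] at this
  refine ⟨(1 + z) / 2, ?_⟩
  field_simp
  linear_combination -hz

theorem aeval_centralPolylog {K : Type*} [Field K] [Algebra (ZMod p) K] {x : K}
    (hx : x * (1 - x) = 1) (s : ℕ) :
    aeval x (centralPolylog p s) = algebraMap (ZMod p) K
      (∑ k ∈ Icc 1 (p - 1), (Nat.centralBinom k : ZMod p) / (k : ZMod p) ^ s) := by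
  rw [centralPolylog, map_sum, map_sum]
  refine sum_congr rfl fun k _ ↦ ?_
  rw [map_mul, aeval_C, map_pow, map_mul, map_sub, map_one, aeval_X, hx, one_pow, mul_one]

theorem aeval_finitePolylog_add {K : Type*} [Field K] [Algebra (ZMod p) K] {x : K}
    (hx : x * (1 - x) = 1) (s : ℕ) :
    aeval x (finitePolylog p s) + aeval (1 - x) (finitePolylog p s) = algebraMap (ZMod p) K
      (evenSum p s (cubeTrace p) - oddSum p s (cubeTrace p)) := by
  rw [← sum_neg_one_pow_mul_cubeTrace, finitePolylog, map_sum, map_sum, map_sum, ← sum_add_distrib]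
  refine sum_congr rfl fun k _ ↦ ?_
  simp only [map_mul, aeval_C, map_pow, aeval_X]
  rw [← mul_add, pow_add_pow_eq_cubeTrace (p := p) hx, ← map_mul, div_eq_inv_mul]

theorem sum_centralBinom_div (hp : 3 < p) :
    ∑ k ∈ Icc 1 (p - 1), (Nat.centralBinom k : ZMod p) / (k : ZMod p) = 0 := by
  obtain ⟨x, hx⟩ := exists_mul_one_sub_eq_one hp
  have hy : (1 - x) * (1 - (1 - x)) = 1 := by linear_combination hx
  have h := aeval_finitePolylog_add (p := p) hx 1
  rw [evenSum_cubeTrace_one hp, sub_self, map_zero] at h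
  have h1 := aeval_centralPolylog (p := p) hx 1
  have h2 := aeval_centralPolylog (p := p) hy 1
  rw [centralPolylog_one (by omega), map_mul, map_ofNat] at h1 h2
  refine (mul_eq_zero.mp ?_).resolve_left (two_ne_zero_of_lt hp)
  refine (algebraMap (ZMod p) (AlgebraicClosure (ZMod p))).injective ?_
  simp only [pow_one] at h1 h2
  rw [map_mul, map_ofNat, map_zero]
  linear_combination 2 * h - h1 - h2

/-- With even and odd sums `E = -5 O`, the evaluation gives `2(E - O) = -12 O`, which is also `3(E +
O)`. -/
theorem sum_centralBinom_div_sq (hp : 3 < p) :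
    ∑ k ∈ Icc 1 (p - 1), (Nat.centralBinom k : ZMod p) / (k : ZMod p) ^ 2 =
      ∑ m ∈ Icc 1 (p / 3), 1 / (m : ZMod p) ^ 2 := by
  obtain ⟨x, hx⟩ := exists_mul_one_sub_eq_one hp
  have h := aeval_finitePolylog_add (p := p) hx 2
  have h1 := aeval_centralPolylog (p := p) hx 2
  rw [centralPolylog_two hp, map_mul, map_ofNat, map_add, aeval_comp, map_sub, map_one, aeval_X,
    h, ← map_ofNat (algebraMap (ZMod p) (AlgebraicClosure (ZMod p))), ← map_mul] at h1
  rw [← (algebraMap (ZMod p) (AlgebraicClosure (ZMod p))).injective h1,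
    ← sum_cubeTrace_div_sq hp, ← evenSum_add_oddSum, evenSum_cubeTrace_two hp]
  ring

end

end

/-! ### Bernoulli polynomials modulo `p`. -/

section
variable {p : ℕ} [Fact p.Prime]

theorem RatReduces.unique {q : ℚ} {x y : ZMod p} (hx : RatReduces p q x) (hy : RatReduces p q y) :
    x = y := by
  obtain ⟨m, d, hd, h1, h2⟩ := hx.sub hy
  have hdq := RatReduces.ne_zero_of_cast hd
  rw [sub_self, eq_comm, div_eq_zero_iff, or_iff_left hdq, Int.cast_eq_zero] at h1
  rw [h1, Int.cast_zero, zero_div] at h2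
  exact sub_eq_zero.mp h2

/-- The defining recursion for the `n`-th Bernoulli number divides only by `n + 1`, a unit modulo
`p` in this range. -/
theorem exists_ratReduces_bernoulli {n : ℕ} (hn : n + 1 < p) :
    ∃ z, RatReduces p (bernoulli n) z := by
  induction n using Nat.strong_induction_on with
  | _ n ih =>
    have h := sum_bernoulli (n + 1)
    rw [sum_range_succ, Nat.choose_succ_self_right] at h
    choose! f hf using ih
    have hs : RatReduces p (∑ k ∈ range n, ((n + 1).choose k : ℚ) * bernoulli k) _ :=
      RatReduces.sum fun k hk ↦ (RatReduces.natCast _).mul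
        (hf k (mem_range.mp hk) (by rw [mem_range] at hk; omega))
    have hite : RatReduces p (if n + 1 = 1 then 1 else 0) (if n + 1 = 1 then 1 else 0) := by
      split_ifs
      · exact RatReduces.one
      · exact RatReduces.zero
    have h0 : ((n + 1 : ℕ) : ZMod p) ≠ 0 := cast_ne_zero_of_lt (by omega) hn
    have hq : bernoulli n = ((if n + 1 = 1 then 1 else 0) -
        ∑ k ∈ range n, ((n + 1).choose k : ℚ) * bernoulli k) / ((n + 1 : ℕ) : ℚ) := by
      rw [eq_div_iff (RatReduces.ne_zero_of_cast h0), ← h]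
      ring
    rw [hq]
    exact ⟨_, (hite.sub hs).div_natCast h0⟩

theorem exists_reduction_bernoulli_polynomial {n : ℕ} (hn : n + 1 < p) :
    ∃ Q : Polynomial (ZMod p), ∀ q z, RatReduces p q z →
      RatReduces p ((Polynomial.bernoulli n).eval q) (Q.eval z) := by
  have h : ∀ i, i ≤ n → ∃ z, RatReduces p (bernoulli i) z :=
    fun i hi ↦ exists_ratReduces_bernoulli (by omega)
  choose! f hf using h
  refine ⟨∑ i ∈ range (n + 1), Polynomial.monomial i (f (n - i) * n.choose i), fun q z hq ↦ ?_⟩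
  simp only [Polynomial.bernoulli_def, Polynomial.eval_finsetSum, Polynomial.eval_monomial]
  exact RatReduces.sum fun i _ ↦
    ((hf _ (Nat.sub_le n i)).mul (RatReduces.natCast _)).mul (hq.pow i)

/-- Fermat turns `1/m^2` into `m^(p-3)`, and Faulhaber gives `-2` times the sum as
`B_{p-2}(⌊p/3⌋+1)`, since `B_{p-2} = 0`. The argument is `1/3` or `2/3` modulo `p` as `p ≡ 2` or `1`
modulo 3; the odd symmetry about `1/2` converts the latter into the Legendre sign. -/
theorem exists_ratReduces_bernoulli_one_third (hp : 3 < p) :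
    ∃ β, RatReduces p ((Polynomial.bernoulli (p - 2)).eval (1 / 3)) β ∧
      ∑ m ∈ Icc 1 (p / 3), 1 / (m : ZMod p) ^ 2 = (legendreSym 3 (p : ℤ) : ZMod p) * β / 2 := by
  have hpp : p.Prime := Fact.out
  have hodd : p % 2 = 1 := hpp.mod_two_eq_one_iff_ne_two.mpr (by omega)
  have h3 := three_ne_zero_of_lt hp
  have h2 := two_ne_zero_of_lt hp
  obtain ⟨Q, hQ⟩ := exists_reduction_bernoulli_polynomial (p := p) (n := p - 2) (by omega)
  have hthird : RatReduces p (1 / 3) (1 / 3) := by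
    have := RatReduces.one.div_natCast (p := p) (d := 3) (by exact_mod_cast h3)
    simpa using this
  refine ⟨Q.eval (1 / 3), hQ _ _ hthird, ?_⟩
  have hsum : ∑ m ∈ Icc 1 (p / 3), 1 / (m : ZMod p) ^ 2 =
      ∑ m ∈ range (p / 3 + 1), (m : ZMod p) ^ (p - 3) := by
    have hr : range (p / 3 + 1) = insert 0 (Icc 1 (p / 3)) := by ext; simp; omega
    rw [hr, sum_insert (by simp), Nat.cast_zero, zero_pow (by omega), zero_add]
    refine sum_congr rfl fun m hm ↦ ?_
    rw [mem_Icc] at hm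
    have hm0 : (m : ZMod p) ≠ 0 := cast_ne_zero_of_lt (by omega) (by omega)
    rw [div_eq_iff (pow_ne_zero 2 hm0), ← pow_add, show p - 3 + 2 = p - 1 by omega,
      ZMod.pow_card_sub_one_eq_one hm0]
  have hfaul := Polynomial.sum_range_pow_eq_bernoulli_sub (p / 3 + 1) (p - 3)
  rw [Nat.succ_eq_add_one, show p - 3 + 1 = p - 2 by omega,
    bernoulli_eq_zero_of_odd (by rw [Nat.odd_iff]; omega) (by omega), sub_zero] at hfaul
  have hL : RatReduces p ((((p - 3 : ℕ) : ℚ) + 1) *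
      ∑ k ∈ range (p / 3 + 1), (k : ℚ) ^ (p - 3)) _ :=
    ((RatReduces.natCast (p - 3)).add RatReduces.one).mul
      (RatReduces.sum fun k _ ↦ (RatReduces.natCast k).pow (p - 3))
  rw [hfaul] at hL
  have hval := hL.unique (hQ _ _ (RatReduces.natCast (p / 3 + 1)))
  rw [← hsum, Nat.cast_sub (by omega), CharP.cast_eq_zero (ZMod p) p] at hval
  have hmod : p % 3 = 1 ∨ p % 3 = 2 := by
    have : p % 3 ≠ 0 := fun h ↦ by
      have := (Nat.prime_dvd_prime_iff_eq Nat.prime_three hpp).mp (Nat.dvd_of_mod_eq_zero h)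
      omega
    omega
  rw [legendreSym.mod]
  rcases hmod with h | h
  · have hN : ((p / 3 + 1 : ℕ) : ZMod p) = 1 - 1 / 3 := by
      have h' : 3 * (p / 3 + 1) = p + 2 := by omega
      have h' := congrArg (Nat.cast : ℕ → ZMod p) h'
      rw [Nat.cast_mul, Nat.cast_add p, CharP.cast_eq_zero (ZMod p) p] at h'
      push_cast at h' ⊢
      field_simp
      linear_combination h'
    have hneg : Q.eval (1 - 1 / 3) = -Q.eval (1 / 3) := by
      have h1 := hQ _ _ (RatReduces.one.sub hthird)
      rw [Polynomial.bernoulli_eval_one_sub,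
        (show Odd (p - 2) by rw [Nat.odd_iff]; omega).neg_one_pow, neg_one_mul] at h1
      exact h1.unique (hQ _ _ hthird).neg
    have hl : legendreSym 3 ((p : ℤ) % (3 : ℕ)) = 1 := by
      rw [show (p : ℤ) % (3 : ℕ) = 1 by omega, legendreSym.at_one]
    rw [hN, hneg] at hval
    rw [hl, eq_div_iff h2]
    push_cast at hval ⊢
    linear_combination -hval
  · have hN : ((p / 3 + 1 : ℕ) : ZMod p) = 1 / 3 := by
      have h' : 3 * (p / 3 + 1) = p + 1 := by omega
      have h' := congrArg (Nat.cast : ℕ → ZMod p) h'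
      rw [Nat.cast_mul, Nat.cast_add p, CharP.cast_eq_zero (ZMod p) p] at h'
      push_cast at h' ⊢
      field_simp
      linear_combination h'
    have hl : legendreSym 3 ((p : ℤ) % (3 : ℕ)) = -1 := by
      rw [show (p : ℤ) % (3 : ℕ) = 2 by omega, legendreSym.eq_neg_one_iff]
      decide
    rw [hN] at hval
    rw [hl, eq_div_iff h2]
    push_cast at hval ⊢
    linear_combination -hval

/-! ### Part (ii): assembling the two sums of `S_k`. -/

theorem sum_weighted_centralBinom_div_sq (hp : 3 < p) :
    ∑ j ∈ Icc 1 (p - 1), (2 * (j : ZMod p) + 1) * Nat.centralBinom j / (j : ZMod p) ^ 2 =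
      ∑ m ∈ Icc 1 (p / 3), 1 / (m : ZMod p) ^ 2 := by
  have h : ∑ j ∈ Icc 1 (p - 1), (2 * (j : ZMod p) + 1) * Nat.centralBinom j / (j : ZMod p) ^ 2 =
      2 * ∑ j ∈ Icc 1 (p - 1), (Nat.centralBinom j : ZMod p) / (j : ZMod p) +
        ∑ j ∈ Icc 1 (p - 1), (Nat.centralBinom j : ZMod p) / (j : ZMod p) ^ 2 := by
    rw [mul_sum, ← sum_add_distrib]
    refine sum_congr rfl fun j hj ↦ ?_
    have := cast_ne_zero_of_mem_Icc hj
    field_simp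
  rw [h, sum_centralBinom_div hp, sum_centralBinom_div_sq hp, mul_zero, zero_add]

theorem sunS_eq_sum_Icc {k : ℕ} (hk : k < p) :
    sunS k = 1 + ∑ j ∈ Icc 1 (p - 1),
      (2 * (j : ℤ) + 1) * Nat.centralBinom j * (k.choose j : ℤ) ^ 2 := by
  have hp := (Fact.out : p.Prime).one_lt
  have hr : range p = insert 0 (Icc 1 (p - 1)) := by ext; simp; omega
  have h : sunS k = ∑ j ∈ range p, (2 * (j : ℤ) + 1) * Nat.centralBinom j * (k.choose j : ℤ) ^ 2 := by
    rw [sunS, sum_subset (range_subset_range.mpr hk)]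
    · refine sum_congr rfl fun j _ ↦ ?_
      rw [Nat.centralBinom]
      ring
    · intro j _ hj
      rw [mem_range] at hj
      rw [Nat.choose_eq_zero_of_lt (by omega)]
      simp
  rw [h, hr, sum_insert (by simp)]
  simp

theorem exists_weighted_sum_choose_sq_div {j : ℕ} (hj : j ∈ Icc 1 (p - 1)) :
    ∃ v, RatReduces p v
        (-((2 * (j : ZMod p) + 1) * (Nat.centralBinom j - 1) / (j : ZMod p) ^ 2)) ∧
      (2 * (j : ℚ) + 1) * Nat.centralBinom j * ∑ k ∈ Icc 1 (p - 1), (k.choose j : ℚ) ^ 2 / k =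
        p * v := by
  have hp := (Fact.out : p.Prime).one_lt
  have hj0 := cast_ne_zero_of_mem_Icc hj
  have hjq := RatReduces.ne_zero_of_cast hj0
  rw [mem_Icc] at hj
  obtain ⟨u, z, hu, h⟩ := exists_sum_choose_sq_div (p := p) (j := j) (by omega)
  have hr : range p = insert 0 (Icc 1 (p - 1)) := by ext; simp; omega
  rw [hr, sum_insert (by simp), Nat.cast_zero, div_zero, zero_add] at h
  refine ⟨(2 * j + 1) * (-(Nat.centralBinom j - 1) + p * u) / (j : ℚ) ^ 2, ?_, ?_⟩
  · have := ((((RatReduces.natCast 2).mul (RatReduces.natCast j)).add RatReduces.one).mul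
      (((RatReduces.natCast (p := p) (Nat.centralBinom j)).sub RatReduces.one).neg.add
        ((RatReduces.natCast p).mul hu))).div_natCast_pow hj0 2
    rw [CharP.cast_eq_zero (ZMod p) p, zero_mul, add_zero, mul_neg, neg_div] at this
    exact_mod_cast this
  · rw [mul_div_assoc', eq_div_iff (pow_ne_zero 2 hjq)]
    linear_combination (2 * (j : ℚ) + 1) * h

/-- Wolstenholme's theorem: pairing `k` with `p - k` gives `p/2` times `∑ 1/(k(p-k)) ≡ -∑ 1/k^2 ≡
0`. -/
theorem exists_harmonic_eq (hp : 3 < p) :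
    ∃ w, RatReduces p w 0 ∧ ∑ k ∈ Icc 1 (p - 1), 1 / (k : ℚ) = p * w := by
  have h2 := two_ne_zero_of_lt hp
  have hrefl : ∑ k ∈ Icc 1 (p - 1), 1 / (k : ℚ) = ∑ k ∈ Icc 1 (p - 1), 1 / ((p - k : ℕ) : ℚ) := by
    refine sum_nbij' (p - ·) (p - ·) ?_ ?_ ?_ ?_ ?_
    all_goals intro k hk; simp only [mem_Icc] at hk ⊢
    · omega
    · omega
    · omega
    · omega
    · rw [Nat.sub_sub_self (by omega)]
  refine ⟨(∑ k ∈ Icc 1 (p - 1), 1 / ((k * (p - k) : ℕ) : ℚ)) / (2 : ℕ), ?_, ?_⟩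
  · have h : RatReduces p ((∑ k ∈ Icc 1 (p - 1), 1 / ((k * (p - k) : ℕ) : ℚ)) / (2 : ℕ))
        ((∑ k ∈ Icc 1 (p - 1), 1 / ((k * (p - k) : ℕ) : ZMod p)) / (2 : ℕ)) := by
      refine (RatReduces.sum fun k hk ↦ RatReduces.one.div_natCast ?_).div_natCast
        (by exact_mod_cast h2)
      rw [mem_Icc] at hk
      push_cast
      exact mul_ne_zero (cast_ne_zero_of_lt (by omega) (by omega))
        (cast_ne_zero_of_lt (by omega) (by omega))
    have h0 : ∑ k ∈ Icc 1 (p - 1), 1 / ((k * (p - k) : ℕ) : ZMod p) = 0 := by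
      rw [← neg_zero, ← sum_inv_sq_eq_zero hp, ← sum_neg_distrib]
      refine sum_congr rfl fun k hk ↦ ?_
      rw [mem_Icc] at hk
      rw [Nat.cast_mul, Nat.cast_sub (by omega), CharP.cast_eq_zero (ZMod p) p, zero_sub, mul_neg,
        ← sq, one_div, one_div, inv_neg]
    rwa [h0, zero_div] at h
  · suffices h : ∑ k ∈ Icc 1 (p - 1), 1 / (k : ℚ) + ∑ k ∈ Icc 1 (p - 1), 1 / (k : ℚ) =
        p * ∑ k ∈ Icc 1 (p - 1), 1 / ((k * (p - k) : ℕ) : ℚ) by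
      push_cast at h ⊢
      linear_combination h / 2
    nth_rewrite 2 [hrefl]
    rw [← sum_add_distrib, mul_sum]
    refine sum_congr rfl fun k hk ↦ ?_
    rw [mem_Icc] at hk
    have hk0 : (k : ℚ) ≠ 0 := by exact_mod_cast (by omega : k ≠ 0)
    have hk1 : ((p - k : ℕ) : ℚ) ≠ 0 := by exact_mod_cast (by omega : p - k ≠ 0)
    have hpk : ((p : ℕ) : ℚ) = k + (p - k : ℕ) := by exact_mod_cast (by omega : p = k + (p - k))
    rw [Nat.cast_mul, hpk]
    field_simp
    ring

theorem exists_sum_sunS_div (hp : 3 < p) :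
    ∃ a, RatReduces p a (-∑ m ∈ Icc 1 (p / 3), 1 / (m : ZMod p) ^ 2) ∧
      ∑ k ∈ Icc 1 (p - 1), (sunS k : ℚ) / k = p * a := by
  obtain ⟨w, hw, hwe⟩ := exists_harmonic_eq (p := p) hp
  have hv := fun j (hj : j ∈ Icc 1 (p - 1)) ↦ exists_weighted_sum_choose_sq_div (p := p) hj
  choose! v hv hve using hv
  refine ⟨w + ∑ j ∈ Icc 1 (p - 1), v j, ?_, ?_⟩
  · have h := hw.add (RatReduces.sum hv)
    have e : (0 : ZMod p) + ∑ j ∈ Icc 1 (p - 1),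
        -((2 * (j : ZMod p) + 1) * (Nat.centralBinom j - 1) / (j : ZMod p) ^ 2) =
        -(∑ j ∈ Icc 1 (p - 1), (2 * (j : ZMod p) + 1) * Nat.centralBinom j / (j : ZMod p) ^ 2) +
        (2 * ∑ j ∈ Icc 1 (p - 1), 1 / (j : ZMod p) +
          ∑ j ∈ Icc 1 (p - 1), 1 / (j : ZMod p) ^ 2) := by
      rw [mul_sum, ← sum_add_distrib, ← sum_neg_distrib, ← sum_add_distrib, zero_add]
      refine sum_congr rfl fun j hj ↦ ?_
      have := cast_ne_zero_of_mem_Icc hj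
      field_simp
      ring
    rw [e, sum_weighted_centralBinom_div_sq hp, sum_inv_eq_zero (by omega),
      sum_inv_sq_eq_zero hp] at h
    simpa using h
  · have h : ∀ k ∈ Icc 1 (p - 1), (sunS k : ℚ) / k = 1 / k + ∑ j ∈ Icc 1 (p - 1),
        (2 * (j : ℚ) + 1) * Nat.centralBinom j * ((k.choose j : ℚ) ^ 2 / k) := by
      intro k hk
      rw [mem_Icc] at hk
      rw [sunS_eq_sum_Icc (p := p) (by omega)]
      push_cast
      rw [add_div, sum_div]
      congr 1
      exact sum_congr rfl fun j _ ↦ mul_div_assoc _ _ _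
    rw [sum_congr rfl h, sum_add_distrib, sum_comm, hwe, mul_add, mul_sum _ v]
    congr 1
    refine sum_congr rfl fun j hj ↦ ?_
    rw [← mul_sum, hve j hj]

/-- With `l = j - 1`, `central_mul_sum_choose_sq` at `n = p` makes the sum over `m < p` vanish
modulo `p`; removing `m = p - 1`, whose square is 1, leaves `-1`. The weight stays on both sides
because `2l + 1`, a factor of `j C(2j,j)`, may be divisible by `p`. -/
theorem centralBinom_mul_sum_choose_sq {j : ℕ} (hj : j ∈ Icc 1 (p - 1)) :
    (Nat.centralBinom j : ZMod p) * ∑ k ∈ Icc 1 (p - 1), ((k - 1).choose (j - 1) : ZMod p) ^ 2 =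
      -Nat.centralBinom j := by
  have hp := (Fact.out : p.Prime).one_lt
  have hj0 := cast_ne_zero_of_mem_Icc hj
  obtain ⟨l, rfl⟩ : ∃ l, j = l + 1 := ⟨j - 1, by rw [mem_Icc] at hj; omega⟩
  rw [mem_Icc] at hj
  have hshift : ∑ k ∈ Icc 1 (p - 1), ((k - 1).choose (l + 1 - 1) : ZMod p) ^ 2 =
      ∑ m ∈ range (p - 1), (m.choose l : ZMod p) ^ 2 := by
    refine sum_nbij' (· - 1) (· + 1) ?_ ?_ ?_ ?_ ?_
    all_goals intro k hk; simp only [mem_Icc, mem_range] at hk ⊢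
    · omega
    · omega
    · omega
    · omega
    · rfl
  have h := congrArg (Nat.cast : ℕ → ZMod p) (central_mul_sum_choose_sq p l)
  rw [Nat.cast_mul p, CharP.cast_eq_zero (ZMod p) p, zero_mul,
    show range p = range (p - 1 + 1) by rw [Nat.sub_add_cancel hp.le], sum_range_succ] at h
  push_cast at h
  rw [choose_pred_sq (by omega)] at h
  have hc : ((l + 1 : ℕ) : ZMod p) * Nat.centralBinom (l + 1) =
      2 * (2 * l + 1) * (2 * l).choose l := by
    exact_mod_cast congrArg (Nat.cast : ℕ → ZMod p) (Nat.succ_mul_centralBinom_succ l)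
  refine mul_left_cancel₀ hj0 ?_
  rw [hshift]
  linear_combination (∑ m ∈ range (p - 1), (m.choose l : ZMod p) ^ 2 + 1) * hc + 2 * h

theorem ratReduces_sum_sunS_div_sq (hp : 3 < p) :
    RatReduces p (∑ k ∈ Icc 1 (p - 1), (sunS k : ℚ) / (k : ℚ) ^ 2)
      (-∑ m ∈ Icc 1 (p / 3), 1 / (m : ZMod p) ^ 2) := by
  have hred : RatReduces p (∑ k ∈ Icc 1 (p - 1), (sunS k : ℚ) / (k : ℚ) ^ 2)
      (∑ k ∈ Icc 1 (p - 1), (sunS k : ZMod p) / (k : ZMod p) ^ 2) :=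
    RatReduces.sum fun k hk ↦ (RatReduces.intCast _).div_natCast_pow (cast_ne_zero_of_mem_Icc hk) 2
  have h : ∀ k ∈ Icc 1 (p - 1), (sunS k : ZMod p) / (k : ZMod p) ^ 2 =
      1 / (k : ZMod p) ^ 2 + ∑ j ∈ Icc 1 (p - 1), (2 * (j : ZMod p) + 1) / (j : ZMod p) ^ 2 *
        (Nat.centralBinom j * ((k - 1).choose (j - 1) : ZMod p) ^ 2) := by
    intro k hk
    have hk0 := cast_ne_zero_of_mem_Icc hk
    rw [mem_Icc] at hk
    rw [sunS_eq_sum_Icc (p := p) (by omega)]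
    push_cast
    rw [add_div, sum_div]
    congr 1
    refine sum_congr rfl fun j hj ↦ ?_
    have hj0 := cast_ne_zero_of_mem_Icc hj
    rw [mem_Icc] at hj
    -- Absorption `C(k,j)/k = C(k-1,j-1)/j` cancels the denominator `k^2`.
    have hkj : (k : ZMod p) * (k - 1).choose (j - 1) = k.choose j * j := by
      have := Nat.add_one_mul_choose_eq (k - 1) (j - 1)
      rw [Nat.sub_add_cancel hk.1, Nat.sub_add_cancel hj.1] at this
      exact_mod_cast congrArg (Nat.cast : ℕ → ZMod p) this
    have hkj' : (k.choose j : ZMod p) = k * (k - 1).choose (j - 1) / j := by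
      rw [hkj]; field_simp
    rw [hkj']
    field_simp
  have hsum : ∑ k ∈ Icc 1 (p - 1), (sunS k : ZMod p) / (k : ZMod p) ^ 2 =
      -∑ m ∈ Icc 1 (p / 3), 1 / (m : ZMod p) ^ 2 := by
    rw [sum_congr rfl h, sum_add_distrib, sum_inv_sq_eq_zero hp, zero_add, sum_comm,
      ← sum_weighted_centralBinom_div_sq hp, ← sum_neg_distrib]
    refine sum_congr rfl fun j hj ↦ ?_
    rw [← mul_sum, ← mul_sum, centralBinom_mul_sum_choose_sq hj]
    ring
  rwa [hsum] at hred

end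

theorem theorem1p4 :
    (∀ n : ℕ, 1 ≤ n →
      (1 / (n : ℚ) ^ 2 * ∑ k ∈ Finset.range n, (sunS k : ℚ) =
          ∑ k ∈ Finset.range n, ((n - 1).choose k : ℚ) ^ 2 * (catalan k : ℚ)) ∧
      (∃ z : ℤ, 1 / (n : ℚ) ^ 2 * ∑ k ∈ Finset.range n, (sunS k : ℚ) = (z : ℚ)) ∧
      (∃ Q : Polynomial ℤ,
        Polynomial.C (1 / (n : ℚ)) *
            ∑ k ∈ Finset.range n, (sunSPoly k).map (Int.castRingHom ℚ) =
          Q.map (Int.castRingHom ℚ))) ∧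
    (∀ p : ℕ, p.Prime → 3 < p →
      RatModEq (p ^ 2)
        (∑ k ∈ Finset.Icc 1 (p - 1), (sunS k : ℚ) / (k : ℚ))
        ((p : ℚ) * ∑ k ∈ Finset.Icc 1 (p - 1), (sunS k : ℚ) / (k : ℚ) ^ 2) ∧
      RatModEq (p ^ 2)
        ((p : ℚ) * ∑ k ∈ Finset.Icc 1 (p - 1), (sunS k : ℚ) / (k : ℚ) ^ 2)
        (-((p : ℚ) / 2) * (legendreSym 3 (p : ℤ) : ℚ) *
          (Polynomial.bernoulli (p - 2)).eval (1 / 3 : ℚ))) := by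
  refine ⟨sunS_part_one, fun p hpp hp ↦ ?_⟩
  have : Fact p.Prime := ⟨hpp⟩
  have hD2 := ratReduces_sum_sunS_div_sq hp
  constructor
  · obtain ⟨a, ha, hae⟩ := exists_sum_sunS_div hp
    rw [hae]
    exact ha.ratModEq hD2
  · obtain ⟨β, hβ, hβe⟩ := exists_ratReduces_bernoulli_one_third hp
    have hR := (((RatReduces.intCast (legendreSym 3 (p : ℤ))).mul hβ).div_natCast (d := 2)
      (by exact_mod_cast two_ne_zero_of_lt hp)).neg
    rw [Nat.cast_ofNat, Nat.cast_ofNat, ← hβe] at hR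
    have := hD2.ratModEq hR
    convert this using 1
    ring
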